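/- **Setting.** Let $\mathcal A$ be a finite set of $n_a$ units. For $a,r\in\mathcal A$ let $E_{ar}:\{0,1\}^{\mathcal A}\to\{0,1\}$ be edge potential outcomes (whether the directed edge $(a,r)$ exists, as a function of the treatment assignment), let $w_{ar},u_{ar}\in\mathbb R$ be weights with $w_{aa}=u_{aa}=0$, and let $\alpha_a,\beta_a,\gamma_a\in\mathbb R$. For $t\in\{0,1\}^{\mathcal A}$ put $$x_a(t)=\sum_r t_rE_{ar}(t)w_{ar},\qquad Y_a(t)=\alpha_a+\beta_ax_a(t)+\gamma_at_a,\qquad z_a(t)=\sum_r t_ru_{ar}.$$ The total treatment effect is $\mu=\frac1{n_a}\sum_a[Y_a(\mathbf 1)-Y_a(\mathbf 0)]$. Let $\mathbf T=(T_r)_{r\in\mathcal A}$ be the random treatment assignment, write $e_{ar},x_a,y_a,z_a$ for $E_{ar}(\mathbf T),x_a(\mathbf T),Y_a(\mathbf T),z_a(\mathbf T)$, and, for $c_{ar}\in\mathbb R$, define $$\hat\beta_a=\frac{y_a(z_a-\mathbb E z_a)}{\mathrm{Cov}(x_a,z_a)},\quad \hat W_a=\sum_r\Big[\frac{T_rw_{ar}(e_{ar}-c_{ar})}{p}+w_{ar}c_{ar}\Big],\quad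 \hat\gamma_a=\frac{T_ay_a}{p}-\frac{(1-T_a)y_a}{1-p},$$ $$\hat\mu_{uni}=\frac1{n_a}\sum_a\big[\hat\beta_a\hat W_a+\hat\gamma_a\big].$$ Let $R_a=\{r:E_{ar}(\mathbf 1)=1\}$, $A_r=\{a:E_{ar}(\mathbf 1)=1\}$, $V_a=\{r:u_{ar}\neq0\}$, $d_{\mathcal A}=\max_a|R_a|$, $d_{\mathcal R}=\max_r|A_r|$. **Assumptions.** Let $p_0>0$, $W_l>0$, $W_h$, $M$ be constants. The $T_r$ are independent Bernoulli($p$) with $p_0\le p\le1-p_0$, and there is a set $G\subset\mathcal A\times\mathcal A$ such that: 1. $E_{ar}(t)$ depends only on $t_r$; 2. $E_{ar}(t)=1$ for all $t$ and all $(a,r)\in G$; 3. $u_{ar}\ne0$ implies $(a,r)\in G$; 4. $c_{ar}=1$ if $(a,r)\in G$ and $c_{ar}=0$ otherwise; 5. $w_{ar}\neq0$ for all $(a,r)\in G$ with $r\ne a$; 6. $V_a\neq\emptyset$ for all $a$, and $u_{ar}\ge0$ for all $a,r$; 7. $W_l/|R_a|\le|w_{ar}|\le W_h/|R_a|$ for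 all $a$ and all $r\in R_a$, $r\neq a$; 8. for each $a$, the weights $w_{ar}$, $r\in V_a$, all have the same sign; 9. $|Y_a(t)|\le M$ for all $a,t$. **Corollary 2.** (i) There is a constant $C$ depending only on $p_0,W_l,W_h,M$ such that $\mathrm{Var}(\hat\mu_{uni})\le C\,d_{\mathcal A}^3d_{\mathcal R}/n_a$ under these assumptions. Consequently, along any sequence of such experiments (with the same constants $p_0,W_l,W_h,M$) with $d_{\mathcal A}^3d_{\mathcal R}/n_a\to0$, the estimator is consistent: $\hat\mu_{uni}-\mu\to0$ in probability. (ii) Along any sequence of such experiments (with the same constants) for which $n_a\mathrm{Var}(\hat\mu_{uni})$ is bounded away from zero and $d_{\mathcal A}^{10}d_{\mathcal R}^4/n_a\to0$, the standardized estimator $(\hat\mu_{uni}-\mu)/\sqrt{\mathrm{Var}(\hat\mu_{uni})}$ converges in distribution to $\mathcal N(0,1)$. -/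

import Mathlib

open MeasureTheory ProbabilityTheory Filter Topology

noncomputable section

/-- The numerical value in `{0, 1}` of a treatment indicator or an edge indicator. -/
def bit (b : Bool) : ℝ := if b then 1 else 0

/-- The data of an experiment on an endogenous unipartite (directed) interference graph with set of
units `ι` (these are both the analysis units and the randomization units), together with the
choices of the researcher. A treatment assignment is a vector `t : ι → Bool`. -/
structure UnipartiteExperiment (ι : Type*) where
  /-- edge potential outcomes: `E a r t` says whether the edge `(a, r)` exists under `t` -/
  E : ι → ι → (ι → Bool) → Bool
  /-- intercepts -/
  α : ι → ℝ
  /-- indirect effects per unit of exposure -/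
  β : ι → ℝ
  /-- direct effects -/
  γ : ι → ℝ
  /-- exposure weights -/
  w : ι → ι → ℝ
  /-- instrument weights -/
  u : ι → ι → ℝ
  /-- augmentation coefficients -/
  c : ι → ι → ℝ
  /-- the (candidate) anchor subgraph -/
  G : Set (ι × ι)

namespace UnipartiteExperiment

variable {ι : Type*} [Fintype ι] {Ω : Type*} [MeasurableSpace Ω]

/-- The exposure `x_a(t) = ∑_r t_r E_{ar}(t) w_{ar}`. -/
def exposure (X : UnipartiteExperiment ι) (a : ι) (t : ι → Bool) : ℝ :=
  ∑ r, bit (t r) * bit (X.E a r t) * X.w a r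

/-- The potential outcome `Y_a(t) = α_a + β_a x_a(t) + γ_a t_a`. -/
def outcome (X : UnipartiteExperiment ι) (a : ι) (t : ι → Bool) : ℝ :=
  X.α a + X.β a * X.exposure a t + X.γ a * bit (t a)

/-- The total treatment effect `μ = (1/n_a) ∑_a [Y_a(1) - Y_a(0)]`. -/
def totalEffect (X : UnipartiteExperiment ι) : ℝ :=
  (1 / (Fintype.card ι : ℝ)) *
    ∑ a, (X.outcome a (fun _ => true) - X.outcome a (fun _ => false))

/-- The instrument `z_a(t) = ∑_r t_r u_{ar}`. -/
def instrument (X : UnipartiteExperiment ι) (a : ι) (t : ι → Bool) : ℝ :=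
  ∑ r, bit (t r) * X.u a r

/-- `R_a`, the units `r` to which `a` is connected under full treatment. -/
def outNbrs (X : UnipartiteExperiment ι) (a : ι) : Finset ι :=
  Finset.univ.filter fun r => X.E a r (fun _ => true) = true

/-- `A_r`, the units `a` that are connected to `r` under full treatment. -/
def inNbrs (X : UnipartiteExperiment ι) (r : ι) : Finset ι :=
  Finset.univ.filter fun a => X.E a r (fun _ => true) = true

/-- `d_A = max_a |R_a|`. -/
def dA (X : UnipartiteExperiment ι) : ℕ := Finset.univ.sup fun a => (X.outNbrs a).card

/-- `d_R = max_r |A_r|`. -/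
def dR (X : UnipartiteExperiment ι) : ℕ := Finset.univ.sup fun r => (X.inNbrs r).card

/-- The estimator `β̂_a = y_a (z_a - 𝔼 z_a) / Cov(x_a, z_a)`, where the treatment assignment is the
random vector `T` on the probability space `(Ω, P)`. -/
def betaHat (X : UnipartiteExperiment ι) (P : Measure Ω) (T : Ω → ι → Bool) (a : ι) (ω : Ω) : ℝ :=
  X.outcome a (T ω) * (X.instrument a (T ω) - ∫ ω', X.instrument a (T ω') ∂P) /
    cov[fun ω' => X.exposure a (T ω'), fun ω' => X.instrument a (T ω'); P]

/-- The estimator `∑_r (T_r w_{ar} (e_{ar} - c_{ar}) / p + w_{ar} c_{ar})` of the total weight of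
the edges that `a` has under full treatment. -/
def weightHat (X : UnipartiteExperiment ι) (p : ℝ) (T : Ω → ι → Bool) (a : ι) (ω : Ω) : ℝ :=
  ∑ r, (bit (T ω r) * X.w a r * (bit (X.E a r (T ω)) - X.c a r) / p + X.w a r * X.c a r)

/-- The estimator `γ̂_a = T_a y_a / p - (1 - T_a) y_a / (1 - p)` of the direct effect. -/
def gammaHat (X : UnipartiteExperiment ι) (p : ℝ) (T : Ω → ι → Bool) (a : ι) (ω : Ω) : ℝ :=
  bit (T ω a) * X.outcome a (T ω) / p - (1 - bit (T ω a)) * X.outcome a (T ω) / (1 - p)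

/-- The estimator `μ̂_uni` of the total treatment effect. -/
def muHat (X : UnipartiteExperiment ι) (P : Measure Ω) (p : ℝ) (T : Ω → ι → Bool) (ω : Ω) : ℝ :=
  (1 / (Fintype.card ι : ℝ)) *
    ∑ a, (X.betaHat P T a ω * X.weightHat p T a ω + X.gammaHat p T a ω)

/-- The treatment assignments are independent Bernoulli random variables with probability `p`. -/
structure IsBernoulliDesign (P : Measure Ω) (p : ℝ) (T : Ω → ι → Bool) : Prop where
  measurable : ∀ r, Measurable fun ω => T ω r
  indep : iIndepFun (fun r ω => T ω r) P
  prob : ∀ r, P.real {ω | T ω r = true} = p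

/-- The assumptions on the experiment other than the assignment mechanism, with the constants
`Wl`, `Wh`, `M`. The conditions on the size of `w a r` are for `r ≠ a`, since `w a a = 0`; a unit
may or may not be connected to itself. -/
structure Assumptions (X : UnipartiteExperiment ι) (Wl Wh M : ℝ) : Prop where
  /-- edges are `r`-driven -/
  r_driven : ∀ a r t t', t r = t' r → X.E a r t = X.E a r t'
  /-- `G` is an anchor subgraph -/
  anchor : ∀ a r, (a, r) ∈ X.G → ∀ t, X.E a r t = true
  u_support : ∀ a r, X.u a r ≠ 0 → (a, r) ∈ X.G
  c_eq : ∀ a r, X.c a r = X.G.indicator 1 (a, r)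
  w_ne_zero : ∀ a r, (a, r) ∈ X.G → r ≠ a → X.w a r ≠ 0
  exists_u_ne_zero : ∀ a, ∃ r, X.u a r ≠ 0
  u_nonneg : ∀ a r, 0 ≤ X.u a r
  w_lower : ∀ a, ∀ r ∈ X.outNbrs a, r ≠ a → Wl / (X.outNbrs a).card ≤ |X.w a r|
  w_upper : ∀ a, ∀ r ∈ X.outNbrs a, r ≠ a → |X.w a r| ≤ Wh / (X.outNbrs a).card
  /-- the weights of the edges used by the instrument of `a` have the same sign -/
  w_same_sign : ∀ a r s, X.u a r ≠ 0 → X.u a s ≠ 0 → 0 < X.w a r * X.w a s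
  outcome_bound : ∀ a t, |X.outcome a t| ≤ M
  w_self : ∀ a, X.w a a = 0
  u_self : ∀ a, X.u a a = 0

end UnipartiteExperiment

end

/-! ### Functions of an independent finite family of random bits -/

section RandomBits

variable {ι : Type*} [Fintype ι] {Ω : Type*} [MeasurableSpace Ω] {P : Measure Ω}
  {T : Ω → ι → Bool}

lemma DependsOn.comp_left {κ : Type*} {α : κ → Type*} {β β' : Type*} {f : (∀ i, α i) → β}
    {s : Set κ} (hf : DependsOn f s) (g : β → β') : DependsOn (fun t => g (f t)) s :=
  fun _ _ h => congrArg g (hf h)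

lemma DependsOn.comp_left₂ {κ : Type*} {α : κ → Type*} {β β' δ : Type*} {f : (∀ i, α i) → β}
    {f' : (∀ i, α i) → β'} {s : Set κ} (hf : DependsOn f s) (hf' : DependsOn f' s)
    (g : β → β' → δ) : DependsOn (fun t => g (f t) (f' t)) s :=
  fun _ _ h => congrArg₂ g (hf h) (hf' h)

lemma DependsOn.fun_sum {κ κ' : Type*} {α : κ → Type*} {β : Type*} [AddCommMonoid β]
    {f : κ' → (∀ i, α i) → β} {s : Set κ} {S : Finset κ'} (hf : ∀ i ∈ S, DependsOn (f i) s) :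
    DependsOn (fun t => ∑ i ∈ S, f i t) s :=
  fun _ _ h => Finset.sum_congr rfl fun i hi => hf i hi h

lemma measurable_comp_of_bits {β : Type*} [MeasurableSpace β] (hT : ∀ r, Measurable fun ω => T ω r)
    (f : (ι → Bool) → β) : Measurable fun ω => f (T ω) :=
  (Measurable.of_discrete (f := f)).comp (measurable_pi_lambda _ hT)

lemma memLp_comp_of_bits [IsProbabilityMeasure P] {E : Type*} [NormedAddCommGroup E]
    [MeasurableSpace E] [BorelSpace E] [SecondCountableTopology E]
    (hT : ∀ r, Measurable fun ω => T ω r) (f : (ι → Bool) → E) (q : ENNReal) :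
    MemLp (fun ω => f (T ω)) q P := by
  classical
  refine MemLp.of_bound (measurable_comp_of_bits hT f).aestronglyMeasurable (∑ t, ‖f t‖)
    (ae_of_all _ fun ω => ?_)
  exact Finset.single_le_sum (f := fun t => ‖f t‖) (fun _ _ => norm_nonneg _) (Finset.mem_univ _)

lemma integrable_comp_of_bits [IsProbabilityMeasure P] {E : Type*} [NormedAddCommGroup E]
    [MeasurableSpace E] [BorelSpace E] [SecondCountableTopology E]
    (hT : ∀ r, Measurable fun ω => T ω r) (f : (ι → Bool) → E) :
    Integrable (fun ω => f (T ω)) P :=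
  memLp_one_iff_integrable.1 (memLp_comp_of_bits hT f 1)

lemma indepFun_of_dependsOn {β β' : Type*} [MeasurableSpace β] [MeasurableSpace β']
    [Nonempty β] [Nonempty β'] (hT : ∀ r, Measurable fun ω => T ω r)
    (hI : iIndepFun (fun r ω => T ω r) P) {f : (ι → Bool) → β} {g : (ι → Bool) → β'}
    {S S' : Finset ι} (hf : DependsOn f (S : Set ι)) (hg : DependsOn g (S' : Set ι))
    (hS : Disjoint S S') : IndepFun (fun ω => f (T ω)) (fun ω => g (T ω)) P := by
  obtain ⟨f', rfl⟩ := dependsOn_iff_exists_comp.1 hf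
  obtain ⟨g', rfl⟩ := dependsOn_iff_exists_comp.1 hg
  have hf' : Measurable f' := Measurable.of_discrete
  have hg' : Measurable g' := Measurable.of_discrete
  exact (hI.indepFun_finset S S' hS hT).comp hf' hg'

lemma integral_mul_of_dependsOn {𝕜 : Type*} [RCLike 𝕜] (hT : ∀ r, Measurable fun ω => T ω r)
    (hI : iIndepFun (fun r ω => T ω r) P) {f g : (ι → Bool) → 𝕜}
    {S S' : Finset ι} (hf : DependsOn f (S : Set ι)) (hg : DependsOn g (S' : Set ι))
    (hS : Disjoint S S') :
    ∫ ω, f (T ω) * g (T ω) ∂P = (∫ ω, f (T ω) ∂P) * ∫ ω, g (T ω) ∂P :=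
  (indepFun_of_dependsOn hT hI hf hg hS).integral_fun_mul_eq_mul_integral
    (measurable_comp_of_bits hT f).aestronglyMeasurable
    (measurable_comp_of_bits hT g).aestronglyMeasurable

lemma abs_integral_le_of_abs_le [IsProbabilityMeasure P] {f : Ω → ℝ} {B : ℝ}
    (h : ∀ ω, |f ω| ≤ B) : |∫ ω, f ω ∂P| ≤ B := by
  simpa using norm_integral_le_of_norm_le_const (μ := P) (f := f) (ae_of_all _ h)

lemma covariance_le_of_abs_le [IsProbabilityMeasure P] (hT : ∀ r, Measurable fun ω => T ω r)
    {f g : (ι → Bool) → ℝ} {B : ℝ} (hf : ∀ t, |f t| ≤ B) (hg : ∀ t, |g t| ≤ B) :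
    cov[fun ω => f (T ω), fun ω => g (T ω); P] ≤ 2 * B ^ 2 := by
  rw [covariance_eq_sub (memLp_comp_of_bits hT f 2) (memLp_comp_of_bits hT g 2)]
  have hB : 0 ≤ B := (abs_nonneg _).trans (hf fun _ => true)
  have h1 : |∫ ω, f (T ω) * g (T ω) ∂P| ≤ B ^ 2 := abs_integral_le_of_abs_le fun ω => by
    rw [abs_mul, sq]
    exact mul_le_mul (hf _) (hg _) (abs_nonneg _) hB
  have h2 : |(∫ ω, f (T ω) ∂P) * ∫ ω, g (T ω) ∂P| ≤ B ^ 2 := by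
    rw [abs_mul, sq]
    exact mul_le_mul (abs_integral_le_of_abs_le fun _ => hf _)
      (abs_integral_le_of_abs_le fun _ => hg _) (abs_nonneg _) hB
  simp only [Pi.mul_apply]
  linarith [le_abs_self (∫ ω, f (T ω) * g (T ω) ∂P),
    neg_abs_le ((∫ ω, f (T ω) ∂P) * ∫ ω, g (T ω) ∂P)]

open Classical in
/-- Variance bound for a sum of bounded variables, each depending on few of the random bits. -/
lemma variance_sum_le_of_dependsOn [IsProbabilityMeasure P]
    (hT : ∀ r, Measurable fun ω => T ω r) (hI : iIndepFun (fun r ω => T ω r) P)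
    {κ : Type*} (s : Finset κ) {S : κ → Finset ι} {h : κ → (ι → Bool) → ℝ}
    (hdep : ∀ k, DependsOn (h k) (S k : Set ι)) {B : ℝ} (hB : ∀ k ∈ s, ∀ t, |h k t| ≤ B) {D : ℝ}
    (hD : ∀ k ∈ s, ((s.filter fun l => ¬ Disjoint (S k) (S l)).card : ℝ) ≤ D) :
    Var[fun ω => ∑ k ∈ s, h k (T ω); P] ≤ 2 * s.card * D * B ^ 2 := by
  rw [variance_fun_sum' fun k _ => memLp_comp_of_bits hT (h k) 2]
  have key : ∀ k ∈ s, ∑ l ∈ s, cov[fun ω => h k (T ω), fun ω => h l (T ω); P] ≤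
      D * (2 * B ^ 2) := by
    intro k hk
    calc ∑ l ∈ s, cov[fun ω => h k (T ω), fun ω => h l (T ω); P]
        = ∑ l ∈ s.filter fun l => ¬ Disjoint (S k) (S l),
            cov[fun ω => h k (T ω), fun ω => h l (T ω); P] := by
          symm
          refine Finset.sum_filter_of_ne (p := fun l => ¬ Disjoint (S k) (S l))
            fun l _ hne hd => hne ?_
          exact (indepFun_of_dependsOn hT hI (hdep k) (hdep l) hd).covariance_eq_zero
            (memLp_comp_of_bits hT _ 2) (memLp_comp_of_bits hT _ 2)
      _ ≤ ∑ l ∈ s.filter fun l => ¬ Disjoint (S k) (S l), 2 * B ^ 2 :=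
          Finset.sum_le_sum fun l hl =>
            covariance_le_of_abs_le hT (hB k hk) (hB l (Finset.mem_filter.1 hl).1)
      _ ≤ D * (2 * B ^ 2) := by
          rw [Finset.sum_const, nsmul_eq_mul]
          exact mul_le_mul_of_nonneg_right (hD k hk) (by positivity)
  calc _ ≤ ∑ k ∈ s, D * (2 * B ^ 2) := Finset.sum_le_sum key
    _ = _ := by rw [Finset.sum_const, nsmul_eq_mul]; ring

end RandomBits

/-! ### Characteristic functions of sums of locally dependent variables -/

section CharFun

open Complex in
lemma norm_exp_I_mul_sub_one_sub_le (x : ℝ) :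
    ‖exp (I * x) - 1 - I * x‖ ≤ 2 * x ^ 2 := by
  have hx : ‖I * (x : ℂ)‖ = |x| := by simp
  rcases le_total |x| 1 with h | h
  · have := norm_exp_sub_one_sub_id_le (x := I * x) (by rw [hx]; exact h)
    rw [hx, sq_abs] at this
    nlinarith [sq_nonneg x]
  · calc ‖exp (I * x) - 1 - I * x‖ ≤ ‖exp (I * x) - 1‖ + ‖I * (x : ℂ)‖ := norm_sub_le _ _
      _ ≤ |x| + |x| := add_le_add Real.norm_exp_I_mul_ofReal_sub_one_le hx.le
      _ ≤ 2 * x ^ 2 := by nlinarith [sq_abs x]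

/-- A Grönwall-type estimate: an approximate solution of `φ' = - s φ` with `φ 0 = 1` is close to the
Gaussian characteristic function. -/
lemma norm_sub_exp_neg_sq_le {φ φ' : ℝ → ℂ} {a b : ℝ} (ha : 0 ≤ a) (hb : 0 ≤ b)
    (hφ : ∀ s, HasDerivAt φ (φ' s) s) (h0 : φ 0 = 1)
    (h : ∀ s, ‖φ' s + s * φ s‖ ≤ |s| * a + s ^ 2 * b) (t : ℝ) :
    ‖φ t - Complex.exp (-(t ^ 2 / 2 : ℝ))‖ ≤ |t| * (|t| * a + t ^ 2 * b) := by
  set e : ℝ → ℂ := fun s => ((Real.exp (s ^ 2 / 2) : ℝ) : ℂ) with he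
  have hed : ∀ s, HasDerivAt e (s * e s) s := by
    intro s
    have h1 : HasDerivAt (fun s : ℝ => Real.exp (s ^ 2 / 2)) (Real.exp (s ^ 2 / 2) * s) s := by
      have := (((hasDerivAt_id s).pow 2).div_const 2).exp
      simpa [mul_comm] using this
    simpa [he, mul_comm] using h1.ofReal_comp
  have hψ : ∀ s ∈ Set.uIcc 0 t, HasDerivWithinAt (fun s => φ s * e s)
      ((φ' s + s * φ s) * e s) (Set.uIcc 0 t) s := by
    intro s _
    refine ((hφ s).mul (hed s)).hasDerivWithinAt.congr_deriv ?_
    ring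
  have hbd : ∀ s ∈ Set.uIcc 0 t, ‖(φ' s + s * φ s) * e s‖ ≤
      (|t| * a + t ^ 2 * b) * Real.exp (t ^ 2 / 2) := by
    intro s hs
    have hst : |s| ≤ |t| := by simpa using Set.abs_sub_left_of_mem_uIcc hs
    have hst2 : s ^ 2 ≤ t ^ 2 := sq_le_sq.2 hst
    rw [norm_mul]
    have : ‖e s‖ = Real.exp (s ^ 2 / 2) := by
      simp only [he, Complex.norm_real]
      exact abs_of_pos (Real.exp_pos _)
    rw [this]
    refine mul_le_mul ((h s).trans ?_) (Real.exp_le_exp.2 (by linarith)) (Real.exp_pos _).le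
      (by positivity)
    gcongr
  have hmv := (convex_uIcc 0 t).norm_image_sub_le_of_norm_hasDerivWithin_le hψ hbd
    Set.left_mem_uIcc Set.right_mem_uIcc
  have hfac : φ t - Complex.exp (-(t ^ 2 / 2 : ℝ)) =
      (φ t * e t - φ 0 * e 0) * (Real.exp (-(t ^ 2 / 2)) : ℝ) := by
    have h1 : e t * (Real.exp (-(t ^ 2 / 2)) : ℝ) = 1 := by
      simp only [he]
      rw [← Complex.ofReal_mul, ← Real.exp_add]
      simp
    have h2 : e 0 = 1 := by simp [he]
    rw [sub_mul, mul_assoc, h1, h0, h2]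
    push_cast
    ring
  rw [hfac, norm_mul, Complex.norm_real, Real.norm_eq_abs, Real.abs_exp]
  calc _ ≤ (|t| * a + t ^ 2 * b) * Real.exp (t ^ 2 / 2) * ‖t - 0‖ * Real.exp (-(t ^ 2 / 2)) := by
        gcongr
    _ = |t| * (|t| * a + t ^ 2 * b) * (Real.exp (t ^ 2 / 2) * Real.exp (-(t ^ 2 / 2))) := by
        rw [sub_zero, Real.norm_eq_abs]; ring
    _ = _ := by rw [← Real.exp_add]; simp

end CharFun

section LocalDependence

variable {ι κ : Type*} [Fintype κ]

open Classical in
/-- The indices whose sets of random bits meet that of `k`. -/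
noncomputable def overlapNbrs (N : κ → Finset ι) (k : κ) : Finset κ :=
  Finset.univ.filter fun l => ¬ Disjoint (N k) (N l)

lemma mem_overlapNbrs {N : κ → Finset ι} {k l : κ} :
    l ∈ overlapNbrs N k ↔ ¬ Disjoint (N k) (N l) := by
  simp [overlapNbrs]

lemma mem_overlapNbrs_comm {N : κ → Finset ι} {k l : κ} :
    l ∈ overlapNbrs N k ↔ k ∈ overlapNbrs N l := by
  simp [mem_overlapNbrs, disjoint_comm]

open Classical in
/-- The ordered pairs of indices whose sets of random bits meet. -/
noncomputable def overlapPairs (N : κ → Finset ι) : Finset (κ × κ) :=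
  Finset.univ.filter fun q => q.2 ∈ overlapNbrs N q.1

lemma sum_overlapPairs {M : Type*} [AddCommMonoid M] (N : κ → Finset ι) (f : κ × κ → M) :
    ∑ q ∈ overlapPairs N, f q = ∑ k, ∑ l ∈ overlapNbrs N k, f (k, l) :=
  Finset.sum_finset_product' _ _ _ (f := fun k l => f (k, l)) (by simp [overlapPairs])

lemma card_overlapPairs_le {N : κ → Finset ι} {D : ℕ} (hD : ∀ k, (overlapNbrs N k).card ≤ D) :
    (overlapPairs N).card ≤ Fintype.card κ * D := by
  rw [Finset.card_eq_sum_ones, sum_overlapPairs]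
  calc _ ≤ ∑ _k : κ, D := Finset.sum_le_sum fun k _ => by simpa using hD k
    _ = _ := by simp

open Classical in
lemma card_filter_overlapPairs_le {N : κ → Finset ι} {D : ℕ}
    (hD : ∀ k, (overlapNbrs N k).card ≤ D) (q : κ × κ) :
    ((overlapPairs N).filter fun q' => ¬ Disjoint (N q.1 ∪ N q.2) (N q'.1 ∪ N q'.2)).card ≤
      4 * D ^ 2 := by
  set A : κ → Finset (κ × κ) := fun i =>
    (overlapNbrs N i).biUnion fun k => (overlapNbrs N k).image fun l => (k, l)
  set A' : κ → Finset (κ × κ) := fun i =>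
    (overlapNbrs N i).biUnion fun l => (overlapNbrs N l).image fun k => (k, l)
  have hA : ∀ i, (A i).card ≤ D * D := fun i =>
    (Finset.card_biUnion_le_card_mul _ _ D fun k _ => Finset.card_image_le.trans (hD k)).trans
      (Nat.mul_le_mul_right _ (hD i))
  have hA' : ∀ i, (A' i).card ≤ D * D := fun i =>
    (Finset.card_biUnion_le_card_mul _ _ D fun k _ => Finset.card_image_le.trans (hD k)).trans
      (Nat.mul_le_mul_right _ (hD i))
  have hsub : ((overlapPairs N).filter fun q' => ¬ Disjoint (N q.1 ∪ N q.2) (N q'.1 ∪ N q'.2)) ⊆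
      (A q.1 ∪ A' q.1) ∪ (A q.2 ∪ A' q.2) := by
    rintro ⟨k, l⟩ hkl
    simp only [overlapPairs, Finset.mem_filter, Finset.mem_univ, true_and] at hkl
    obtain ⟨hkl, hd⟩ := hkl
    have hlk := mem_overlapNbrs_comm.1 hkl
    simp only [Finset.disjoint_union_left, Finset.disjoint_union_right, not_and_or,
      ← mem_overlapNbrs] at hd
    simp only [A, A', Finset.mem_union, Finset.mem_biUnion, Finset.mem_image, Prod.mk.injEq]
    rcases hd with (h | h) | (h | h)
    · exact Or.inl (Or.inl ⟨k, h, l, hkl, rfl, rfl⟩)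
    · exact Or.inr (Or.inl ⟨k, h, l, hkl, rfl, rfl⟩)
    · exact Or.inl (Or.inr ⟨l, h, k, hlk, rfl, rfl⟩)
    · exact Or.inr (Or.inr ⟨l, h, k, hlk, rfl, rfl⟩)
  calc _ ≤ _ := Finset.card_le_card hsub
    _ ≤ ((A q.1).card + (A' q.1).card) + ((A q.2).card + (A' q.2).card) :=
      (Finset.card_union_le _ _).trans
        (add_le_add (Finset.card_union_le _ _) (Finset.card_union_le _ _))
    _ ≤ 4 * D ^ 2 := by nlinarith [hA q.1, hA' q.1, hA q.2, hA' q.2]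

variable [Fintype ι] {Ω : Type*} [MeasurableSpace Ω] {P : Measure Ω} {T : Ω → ι → Bool}
  {N : κ → Finset ι} {h : κ → (ι → Bool) → ℝ} {B : ℝ} {D : ℕ}

lemma variance_sum_mul_overlap_le [IsProbabilityMeasure P] (hT : ∀ r, Measurable fun ω => T ω r)
    (hI : iIndepFun (fun r ω => T ω r) P) (hdep : ∀ k, DependsOn (h k) (N k : Set ι))
    (hB : ∀ k t, |h k t| ≤ B) (hD : ∀ k, (overlapNbrs N k).card ≤ D) :
    Var[fun ω => ∑ k, h k (T ω) * ∑ l ∈ overlapNbrs N k, h l (T ω); P] ≤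
      8 * Fintype.card κ * D ^ 3 * B ^ 4 := by
  classical
  have heq : (fun ω => ∑ k, h k (T ω) * ∑ l ∈ overlapNbrs N k, h l (T ω)) =
      fun ω => ∑ q ∈ overlapPairs N, h q.1 (T ω) * h q.2 (T ω) := by
    funext ω
    rw [sum_overlapPairs]
    simp only [Finset.mul_sum]
  rw [heq]
  have hdep2 : ∀ q : κ × κ, DependsOn (fun t => h q.1 t * h q.2 t)
      ((N q.1 ∪ N q.2 : Finset ι) : Set ι) := fun q =>
    ((hdep q.1).mono (by simp)).comp_left₂ ((hdep q.2).mono (by simp)) (· * ·)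
  have hB2 : ∀ q ∈ overlapPairs N, ∀ t, |h q.1 t * h q.2 t| ≤ B ^ 2 := fun q _ t => by
    rw [abs_mul, sq]
    exact mul_le_mul (hB _ _) (hB _ _) (abs_nonneg _) ((abs_nonneg _).trans (hB q.1 t))
  refine (variance_sum_le_of_dependsOn hT hI (overlapPairs N) (S := fun q => N q.1 ∪ N q.2) hdep2
    hB2 (D := 4 * (D : ℝ) ^ 2) fun q _ => ?_).trans ?_
  · have := (Nat.cast_le (α := ℝ)).2 (card_filter_overlapPairs_le hD q)
    push_cast at this
    convert this
  · have h1 : ((overlapPairs N).card : ℝ) ≤ Fintype.card κ * D := by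
      exact_mod_cast card_overlapPairs_le hD
    calc 2 * ((overlapPairs N).card : ℝ) * (4 * (D : ℝ) ^ 2) * (B ^ 2) ^ 2
        ≤ 2 * (Fintype.card κ * D) * (4 * (D : ℝ) ^ 2) * (B ^ 2) ^ 2 := by gcongr
      _ = _ := by ring

lemma integral_sum_mul_overlap [IsProbabilityMeasure P] (hT : ∀ r, Measurable fun ω => T ω r)
    (hI : iIndepFun (fun r ω => T ω r) P) (hdep : ∀ k, DependsOn (h k) (N k : Set ι))
    (h0 : ∀ k, ∫ ω, h k (T ω) ∂P = 0) :
    ∫ ω, ∑ k, h k (T ω) * ∑ l ∈ overlapNbrs N k, h l (T ω) ∂P =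
      ∫ ω, (∑ k, h k (T ω)) ^ 2 ∂P := by
  have hinteg : ∀ k l, Integrable (fun ω => h k (T ω) * h l (T ω)) P := fun k l =>
    integrable_comp_of_bits hT fun t => h k t * h l t
  simp only [sq, Finset.sum_mul_sum]
  simp only [Finset.mul_sum]
  rw [integral_finsetSum _ fun k _ => integrable_finsetSum _ fun l _ => hinteg k l,
    integral_finsetSum _ fun k _ => integrable_finsetSum _ fun l _ => hinteg k l]
  refine Finset.sum_congr rfl fun k _ => ?_
  rw [integral_finsetSum _ fun l _ => hinteg k l, integral_finsetSum _ fun l _ => hinteg k l]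
  refine Finset.sum_subset (Finset.subset_univ _) fun l _ hl => ?_
  rw [mem_overlapNbrs, not_not] at hl
  rw [integral_mul_of_dependsOn hT hI (hdep k) (hdep l) hl, h0, zero_mul]

lemma integral_abs_le_sqrt_of_bits [IsProbabilityMeasure P] (hT : ∀ r, Measurable fun ω => T ω r)
    (f : (ι → Bool) → ℝ) : ∫ ω, |f (T ω)| ∂P ≤ Real.sqrt (∫ ω, f (T ω) ^ 2 ∂P) := by
  refine Real.le_sqrt_of_sq_le ?_
  have h1 := variance_eq_sub (memLp_comp_of_bits (P := P) hT (fun t => |f t|) 2)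
  have h2 := variance_nonneg (fun ω => |f (T ω)|) P
  simp only [Pi.pow_apply, sq_abs] at h1
  linarith

open Complex in
/-- The Stein identity, up to an error, for the functions `x ↦ exp (i s x)` and a sum of centered
locally dependent variables. -/
lemma norm_integral_mul_exp_sub_le [IsProbabilityMeasure P] (hT : ∀ r, Measurable fun ω => T ω r)
    (hI : iIndepFun (fun r ω => T ω r) P) (hdep : ∀ k, DependsOn (h k) (N k : Set ι))
    (hB : ∀ k t, |h k t| ≤ B) (hB0 : 0 ≤ B) (hD : ∀ k, (overlapNbrs N k).card ≤ D)
    (h0 : ∀ k, ∫ ω, h k (T ω) ∂P = 0) (h1 : ∫ ω, (∑ k, h k (T ω)) ^ 2 ∂P = 1) (s : ℝ) :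
    ‖∫ ω, ((∑ k, h k (T ω) : ℝ) : ℂ) * exp (I * (s * ∑ k, h k (T ω) : ℝ)) ∂P -
        I * s * ∫ ω, exp (I * (s * ∑ k, h k (T ω) : ℝ)) ∂P‖ ≤
      |s| * Real.sqrt (8 * Fintype.card κ * D ^ 3 * B ^ 4) +
        s ^ 2 * (2 * Fintype.card κ * D ^ 2 * B ^ 3) := by
  classical
  set W : (ι → Bool) → ℝ := fun t => ∑ k, h k t with hW
  set S : κ → (ι → Bool) → ℝ := fun k t => ∑ l ∈ overlapNbrs N k, h l t with hS
  set Q : (ι → Bool) → ℝ := fun t => ∑ k, h k t * S k t with hQ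
  set F : (ι → Bool) → ℂ := fun t => exp (I * (s * W t : ℝ)) with hF
  set Fk : κ → (ι → Bool) → ℂ := fun k t => exp (I * (s * (W t - S k t) : ℝ)) with hFk
  have hFn : ∀ t, ‖F t‖ = 1 := fun t => norm_exp_I_mul_ofReal _
  have hSB : ∀ k t, |S k t| ≤ D * B := fun k t => by
    calc |S k t| ≤ ∑ l ∈ overlapNbrs N k, |h l t| := Finset.abs_sum_le_sum_abs _ _
      _ ≤ ∑ l ∈ overlapNbrs N k, B := Finset.sum_le_sum fun l _ => hB l t
      _ = (overlapNbrs N k).card * B := by simp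
      _ ≤ D * B := by gcongr; exact hD k
  -- the leave-one-neighbourhood-out terms vanish
  have hzero : ∀ k, ∫ ω, ((h k (T ω) : ℝ) : ℂ) * Fk k (T ω) ∂P = 0 := by
    intro k
    have hd1 : DependsOn (fun t => W t - S k t) (((N k)ᶜ : Finset ι) : Set ι) := by
      have : (fun t => W t - S k t) = fun t => ∑ l ∈ (overlapNbrs N k)ᶜ, h l t := by
        funext t
        rw [sub_eq_iff_eq_add]
        exact (Finset.sum_compl_add_sum _ _).symm
      rw [this]
      refine DependsOn.fun_sum fun l hl => (hdep l).mono ?_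
      rw [Finset.mem_compl, mem_overlapNbrs, not_not] at hl
      rw [Finset.coe_subset]
      exact fun x hx => Finset.mem_compl.2 fun hx' => Finset.disjoint_left.1 hl hx' hx
    have := integral_mul_of_dependsOn hT hI (f := fun t => ((h k t : ℝ) : ℂ)) (g := Fk k)
      ((hdep k).comp_left _) (hd1.comp_left fun x => exp (I * (s * x : ℝ))) disjoint_compl_right
    rw [this, integral_complex_ofReal, h0]
    simp
  have hinteg : ∀ f : (ι → Bool) → ℂ, Integrable (fun ω => f (T ω)) P :=
    fun f => integrable_comp_of_bits hT f
  have hlhs : ∫ ω, ((W (T ω) : ℝ) : ℂ) * F (T ω) ∂P - I * s * ∫ ω, F (T ω) ∂P =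
      ∫ ω, (((W (T ω) : ℝ) : ℂ) * F (T ω) - I * s * F (T ω) -
        ∑ k, ((h k (T ω) : ℝ) : ℂ) * Fk k (T ω)) ∂P := by
    rw [integral_sub (hinteg fun t => (W t : ℂ) * F t - I * s * F t)
        (hinteg fun t => ∑ k, ((h k t : ℝ) : ℂ) * Fk k t),
      integral_sub (hinteg fun t => (W t : ℂ) * F t) (hinteg fun t => I * s * F t),
      integral_const_mul,
      integral_finsetSum _ fun k _ => hinteg fun t => ((h k t : ℝ) : ℂ) * Fk k t,
      Finset.sum_eq_zero fun k _ => hzero k, sub_zero]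
  have hpt : ∀ t, ‖((W t : ℝ) : ℂ) * F t - I * s * F t - ∑ k, ((h k t : ℝ) : ℂ) * Fk k t‖ ≤
      |s| * |Q t - 1| + s ^ 2 * (2 * Fintype.card κ * D ^ 2 * B ^ 3) := by
    intro t
    set ρ : κ → ℂ := fun k => exp (I * (-(s * S k t) : ℝ)) - 1 - I * (-(s * S k t) : ℝ) with hρ
    have hFkt : ∀ k, Fk k t = F t - F t * (I * s * S k t) + F t * ρ k := by
      intro k
      have : Fk k t = F t * exp (I * (-(s * S k t) : ℝ)) := by
        simp only [hFk, hF]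
        rw [← exp_add]
        congr 1
        push_cast
        ring
      rw [this]
      simp only [hρ]
      push_cast
      ring
    have hid : ((W t : ℝ) : ℂ) * F t - I * s * F t - ∑ k, ((h k t : ℝ) : ℂ) * Fk k t =
        I * s * ((Q t - 1 : ℝ) : ℂ) * F t - ∑ k, ((h k t : ℝ) : ℂ) * (F t * ρ k) := by
      simp only [hFkt, mul_add, mul_sub, Finset.sum_add_distrib, Finset.sum_sub_distrib]
      have e1 : ∑ k, ((h k t : ℝ) : ℂ) * F t = (W t : ℂ) * F t := by
        simp only [hW]; push_cast; rw [Finset.sum_mul]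
      have e2 : ∑ k, ((h k t : ℝ) : ℂ) * (F t * (I * s * S k t)) = I * s * (Q t : ℂ) * F t := by
        simp only [hQ]; push_cast; rw [Finset.mul_sum, Finset.sum_mul]
        exact Finset.sum_congr rfl fun k _ => by ring
      rw [e1, e2]
      push_cast
      ring
    rw [hid]
    refine (norm_sub_le _ _).trans (add_le_add ?_ ?_)
    · rw [norm_mul, norm_mul, norm_mul, hFn, norm_real, norm_real, norm_I, one_mul, mul_one]
      rfl
    · refine (norm_sum_le _ _).trans ?_
      have : ∀ k ∈ Finset.univ, ‖((h k t : ℝ) : ℂ) * (F t * ρ k)‖ ≤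
          B * (2 * (s ^ 2 * (D * B) ^ 2)) := by
        intro k _
        rw [norm_mul, norm_mul, hFn, one_mul, norm_real]
        refine mul_le_mul (hB k t) ?_ (norm_nonneg _) hB0
        refine (norm_exp_I_mul_sub_one_sub_le _).trans ?_
        have := sq_le_sq' (abs_le.1 (hSB k t)).1 (abs_le.1 (hSB k t)).2
        rw [neg_sq, mul_pow]
        gcongr
      refine (Finset.sum_le_sum this).trans (le_of_eq ?_)
      rw [Finset.sum_const, Finset.card_univ, nsmul_eq_mul]
      ring
  have hEQ : ∫ ω, Q (T ω) ∂P = 1 := (integral_sum_mul_overlap hT hI hdep h0).trans h1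
  have hQ1 : ∫ ω, |Q (T ω) - 1| ∂P ≤ Real.sqrt (8 * Fintype.card κ * D ^ 3 * B ^ 4) := by
    refine (integral_abs_le_sqrt_of_bits hT fun t => Q t - 1).trans (Real.sqrt_le_sqrt ?_)
    refine le_trans (le_of_eq ?_) (variance_sum_mul_overlap_le hT hI hdep hB hD)
    rw [variance_eq_integral (measurable_comp_of_bits hT Q).aemeasurable]
    exact integral_congr_ae (ae_of_all _ fun ω => by simp only [hEQ])
  rw [hlhs]
  have hi : Integrable (fun ω => |s| * |Q (T ω) - 1|) P :=
    integrable_comp_of_bits hT fun t => |s| * |Q t - 1|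
  calc _ ≤ ∫ ω, (|s| * |Q (T ω) - 1| + s ^ 2 * (2 * Fintype.card κ * D ^ 2 * B ^ 3)) ∂P :=
        norm_integral_le_of_norm_le (hi.add (integrable_const _)) (ae_of_all _ fun ω => hpt _)
    _ = |s| * ∫ ω, |Q (T ω) - 1| ∂P + s ^ 2 * (2 * Fintype.card κ * D ^ 2 * B ^ 3) := by
        rw [integral_add hi (integrable_const _), integral_const_mul]
        simp
    _ ≤ _ := by gcongr

open Complex in
/-- Quantitative central limit theorem for the characteristic function of a sum of centered bounded
locally dependent variables with unit variance. -/
lemma norm_charFun_sub_gaussian_le [IsProbabilityMeasure P] (hT : ∀ r, Measurable fun ω => T ω r)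
    (hI : iIndepFun (fun r ω => T ω r) P) (hdep : ∀ k, DependsOn (h k) (N k : Set ι))
    (hB : ∀ k t, |h k t| ≤ B) (hB0 : 0 ≤ B) (hD : ∀ k, (overlapNbrs N k).card ≤ D)
    (h0 : ∀ k, ∫ ω, h k (T ω) ∂P = 0) (h1 : ∫ ω, (∑ k, h k (T ω)) ^ 2 ∂P = 1) (t : ℝ) :
    ‖charFun (P.map fun ω => ∑ k, h k (T ω)) t - charFun (gaussianReal 0 1) t‖ ≤
      |t| * (|t| * Real.sqrt (8 * Fintype.card κ * D ^ 3 * B ^ 4) +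
        t ^ 2 * (2 * Fintype.card κ * D ^ 2 * B ^ 3)) := by
  set W : (ι → Bool) → ℝ := fun t => ∑ k, h k t with hW
  set φ : ℝ → ℂ := fun s => ∫ ω, exp (I * (s * W (T ω) : ℝ)) ∂P with hφ
  have hchar : charFun (P.map fun ω => ∑ k, h k (T ω)) t = φ t := by
    rw [charFun_apply_real, integral_map (measurable_comp_of_bits hT W).aemeasurable (by fun_prop)]
    refine integral_congr_ae (ae_of_all _ fun ω => ?_)
    simp only [hW]
    push_cast
    congr 1
    ring
  have hgauss : charFun (gaussianReal 0 1) t = exp (-(t ^ 2 / 2 : ℝ)) := by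
    rw [charFun_gaussianReal]
    push_cast
    congr 1
    simp
  have hderiv : ∀ s, HasDerivAt φ
      (∫ ω, I * ((W (T ω) : ℝ) : ℂ) * exp (I * (s * W (T ω) : ℝ)) ∂P) s := by
    intro s
    refine (hasDerivAt_integral_of_dominated_loc_of_deriv_le (μ := P) (s := Set.univ)
      (F := fun s ω => exp (I * (s * W (T ω) : ℝ)))
      (F' := fun s ω => I * ((W (T ω) : ℝ) : ℂ) * exp (I * (s * W (T ω) : ℝ)))
      (bound := fun ω => |W (T ω)|) univ_mem
      (Eventually.of_forall fun s' =>
        (measurable_comp_of_bits hT fun t => exp (I * (s' * W t : ℝ))).aestronglyMeasurable)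
      (integrable_comp_of_bits hT fun t => exp (I * (s * W t : ℝ)))
      (measurable_comp_of_bits hT
        fun t => I * ((W t : ℝ) : ℂ) * exp (I * (s * W t : ℝ))).aestronglyMeasurable
      (ae_of_all _ fun ω s' _ => ?_) (integrable_comp_of_bits hT fun t => |W t|)
      (ae_of_all _ fun ω s' _ => ?_)).2
    · rw [norm_mul, norm_exp_I_mul_ofReal]
      simp
    · have hd : HasDerivAt (fun s : ℝ => I * ((s * W (T ω) : ℝ) : ℂ)) (I * (W (T ω) : ℂ)) s' := by
        have := ((hasDerivAt_id s').mul_const (W (T ω))).ofReal_comp.const_mul I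
        simpa using this
      simpa [mul_comm] using hd.cexp
  rw [hchar, hgauss]
  refine norm_sub_exp_neg_sq_le (Real.sqrt_nonneg _) (by positivity) hderiv (by simp [hφ])
    (fun s => ?_) t
  have hst := norm_integral_mul_exp_sub_le hT hI hdep hB hB0 hD h0 h1 s
  have hmul : (∫ ω, I * ((W (T ω) : ℝ) : ℂ) * exp (I * (s * W (T ω) : ℝ)) ∂P) + s * φ s =
      I * (∫ ω, ((W (T ω) : ℝ) : ℂ) * exp (I * (s * W (T ω) : ℝ)) ∂P - I * s * φ s) := by
    simp only [mul_assoc, integral_const_mul]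
    rw [mul_sub]
    linear_combination ((s : ℂ) * φ s) * I_mul_I
  rw [hmul, norm_mul, norm_I, one_mul]
  exact hst

end LocalDependence

/-! ### The estimator of the total treatment effect -/

lemma bit_nonneg (b : Bool) : 0 ≤ bit b := by cases b <;> simp [bit]

lemma bit_le_one (b : Bool) : bit b ≤ 1 := by cases b <;> simp [bit]

lemma bit_mul_self (b : Bool) : bit b * bit b = bit b := by cases b <;> simp [bit]

lemma dependsOn_bit {ι : Type*} {s : Set ι} {r : ι} (hr : r ∈ s) :
    DependsOn (fun t : ι → Bool => bit (t r)) s :=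
  fun _ _ h => congrArg bit (h r hr)

lemma dependsOn_sum_bit_mul {ι : Type*} [Fintype ι] {f : ι → ℝ} {s : Set ι}
    (h : ∀ r, r ∉ s → f r = 0) : DependsOn (fun t : ι → Bool => ∑ r, bit (t r) * f r) s := by
  intro t t' htt'
  refine Finset.sum_congr rfl fun r _ => ?_
  by_cases hr : r ∈ s
  · rw [htt' r hr]
  · rw [h r hr, mul_zero, mul_zero]

namespace UnipartiteExperiment

variable {ι : Type*} {Ω : Type*} [MeasurableSpace Ω] {P : Measure Ω} {p : ℝ} {T : Ω → ι → Bool}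

namespace IsBernoulliDesign

lemma integral_bit [IsProbabilityMeasure P] (h : IsBernoulliDesign P p T) (r : ι) :
    ∫ ω, bit (T ω r) ∂P = p := by
  have hm : MeasurableSet {ω | T ω r = true} := h.measurable r (measurableSet_singleton true)
  have : (fun ω => bit (T ω r)) = {ω | T ω r = true}.indicator 1 := by
    funext ω
    by_cases hω : T ω r = true <;> simp [bit, hω]
  rw [this, integral_indicator_one hm, h.prob r]

variable [Fintype ι]

lemma integral_sum_bit_mul [IsProbabilityMeasure P] (h : IsBernoulliDesign P p T) (f : ι → ℝ) :
    ∫ ω, ∑ r, bit (T ω r) * f r ∂P = p * ∑ r, f r := by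
  rw [integral_finsetSum _ fun r _ =>
    integrable_comp_of_bits h.measurable fun t => bit (t r) * f r, Finset.mul_sum]
  exact Finset.sum_congr rfl fun r _ => by rw [integral_mul_const, h.integral_bit]

lemma covariance_bit [IsProbabilityMeasure P] [DecidableEq ι] (h : IsBernoulliDesign P p T)
    (r s : ι) :
    cov[fun ω => bit (T ω r), fun ω => bit (T ω s); P] = if r = s then p * (1 - p) else 0 := by
  have hL : ∀ r, MemLp (fun ω => bit (T ω r)) 2 P := fun r =>
    memLp_comp_of_bits h.measurable (fun t => bit (t r)) 2
  have hdep : ∀ r : ι, DependsOn (fun t : ι → Bool => bit (t r)) (({r} : Finset ι) : Set ι) :=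
    fun r => dependsOn_bit (by simp)
  split_ifs with hrs
  · subst hrs
    rw [covariance_eq_sub (hL r) (hL r)]
    simp only [Pi.mul_apply, bit_mul_self, h.integral_bit]
    ring
  · exact (indepFun_of_dependsOn h.measurable h.indep (hdep r) (hdep s)
      (by simpa using hrs)).covariance_eq_zero (hL r) (hL s)

lemma covariance_sum_bit_mul [IsProbabilityMeasure P] (h : IsBernoulliDesign P p T) (f g : ι → ℝ) :
    cov[fun ω => ∑ r, bit (T ω r) * f r, fun ω => ∑ r, bit (T ω r) * g r; P] =
      p * (1 - p) * ∑ r, f r * g r := by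
  classical
  rw [covariance_fun_sum_fun_sum
    (fun r => memLp_comp_of_bits h.measurable (fun t => bit (t r) * f r) 2)
    (fun r => memLp_comp_of_bits h.measurable (fun t => bit (t r) * g r) 2), Finset.mul_sum]
  refine Finset.sum_congr rfl fun r _ => ?_
  simp only [covariance_mul_const_left, covariance_mul_const_right, h.covariance_bit]
  simp
  ring

end IsBernoulliDesign

variable [Fintype ι]

/-- Indicator of the edge `(a, r)` under full treatment. -/
noncomputable def edge (X : UnipartiteExperiment ι) (a r : ι) : ℝ := bit (X.E a r fun _ => true)

/-- The covariance of exposure and instrument, up to the factor `p (1 - p)`. -/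
noncomputable def strength (X : UnipartiteExperiment ι) (a : ι) : ℝ := ∑ r, X.w a r * X.u a r

/-- The contribution of the unit `a` to the estimator, as a function of the treatment assignment. -/
noncomputable def contrib (X : UnipartiteExperiment ι) (p : ℝ) (a : ι) (t : ι → Bool) : ℝ :=
  X.outcome a t * (X.instrument a t - p * ∑ r, X.u a r) / (p * (1 - p) * X.strength a) *
      X.weightHat p (fun t : ι → Bool => t) a t +
    X.gammaHat p (fun t : ι → Bool => t) a t

open Classical in
/-- The units whose treatments enter the contribution of `a`. -/
noncomputable def support (X : UnipartiteExperiment ι) (a : ι) : Finset ι :=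
  insert a (X.outNbrs a)

namespace Assumptions

variable {X : UnipartiteExperiment ι} {Wl Wh M : ℝ}

lemma bit_mul_bit (A : X.Assumptions Wl Wh M) (a r : ι) (t : ι → Bool) :
    bit (t r) * bit (X.E a r t) = bit (t r) * X.edge a r := by
  cases h : t r
  · simp [bit]
  · rw [edge, A.r_driven a r t (fun _ => true) (by simpa using h)]

lemma edge_eq_one (A : X.Assumptions Wl Wh M) {a r : ι} (h : (a, r) ∈ X.G) : X.edge a r = 1 := by
  simp [edge, bit, A.anchor a r h]

lemma edge_eq_one_of_mem {a r : ι} (h : r ∈ X.outNbrs a) : X.edge a r = 1 := by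
  simp_all [outNbrs, edge, bit]

lemma edge_eq_zero {a r : ι} (h : r ∉ X.outNbrs a) : X.edge a r = 0 := by
  simp_all [outNbrs, edge, bit]

lemma mem_outNbrs (A : X.Assumptions Wl Wh M) {a r : ι} (h : (a, r) ∈ X.G) :
    r ∈ X.outNbrs a := by
  simp [outNbrs, A.anchor a r h]

lemma c_of_mem (A : X.Assumptions Wl Wh M) {a r : ι} (h : (a, r) ∈ X.G) : X.c a r = 1 := by
  simp [A.c_eq, h]

lemma c_of_notMem (A : X.Assumptions Wl Wh M) {a r : ι} (h : (a, r) ∉ X.G) : X.c a r = 0 := by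
  simp [A.c_eq, h]

lemma edge_mul_u (A : X.Assumptions Wl Wh M) (a r : ι) : X.edge a r * X.u a r = X.u a r := by
  by_cases h : X.u a r = 0
  · simp [h]
  · rw [A.edge_eq_one (A.u_support a r h), one_mul]

lemma c_mul_u (A : X.Assumptions Wl Wh M) (a r : ι) : X.c a r * X.u a r = X.u a r := by
  by_cases h : X.u a r = 0
  · simp [h]
  · rw [A.c_of_mem (A.u_support a r h), one_mul]

lemma exposure_eq (A : X.Assumptions Wl Wh M) (a : ι) (t : ι → Bool) :
    X.exposure a t = ∑ r, bit (t r) * (X.edge a r * X.w a r) :=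
  Finset.sum_congr rfl fun r _ => by rw [A.bit_mul_bit, mul_assoc]

lemma weightHat_eq (A : X.Assumptions Wl Wh M) {Ω' : Type*} (p : ℝ) (T : Ω' → ι → Bool) (a : ι)
    (ω : Ω') :
    X.weightHat p T a ω = ∑ r, bit (T ω r) * (X.w a r * (X.edge a r - X.c a r) / p) +
      ∑ r, X.w a r * X.c a r := by
  rw [weightHat, ← Finset.sum_add_distrib]
  refine Finset.sum_congr rfl fun r _ => ?_
  linear_combination (X.w a r / p) * A.bit_mul_bit a r (T ω)

lemma cov_exposure_instrument [IsProbabilityMeasure P] (A : X.Assumptions Wl Wh M)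
    (h : IsBernoulliDesign P p T) (a : ι) :
    cov[fun ω => X.exposure a (T ω), fun ω => X.instrument a (T ω); P] =
      p * (1 - p) * X.strength a := by
  simp only [A.exposure_eq, instrument]
  rw [h.covariance_sum_bit_mul, strength]
  congr 1
  exact Finset.sum_congr rfl fun r _ => by linear_combination X.w a r * A.edge_mul_u a r

lemma integral_instrument [IsProbabilityMeasure P] (h : IsBernoulliDesign P p T) (a : ι) :
    ∫ ω, X.instrument a (T ω) ∂P = p * ∑ r, X.u a r :=
  h.integral_sum_bit_mul _

lemma muHat_eq [IsProbabilityMeasure P] (A : X.Assumptions Wl Wh M)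
    (h : IsBernoulliDesign P p T) :
    X.muHat P p T = fun ω => (1 / (Fintype.card ι : ℝ)) * ∑ a, X.contrib p a (T ω) := by
  funext ω
  rw [muHat]
  congr 1
  refine Finset.sum_congr rfl fun a _ => ?_
  rw [betaHat, A.cov_exposure_instrument h, integral_instrument h]
  rfl

/-! #### Local dependence -/

lemma dependsOn_outcome (A : X.Assumptions Wl Wh M) (a : ι) :
    DependsOn (X.outcome a) (X.support a : Set ι) := by
  have h1 : DependsOn (X.exposure a) (X.support a : Set ι) := by
    rw [funext (A.exposure_eq a)]
    refine dependsOn_sum_bit_mul fun r hr => ?_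
    rw [edge_eq_zero fun h => hr (by simp [support, h]), zero_mul]
  have h2 : DependsOn (fun t : ι → Bool => bit (t a)) (X.support a : Set ι) :=
    dependsOn_bit (by simp [support])
  exact h1.comp_left₂ h2 fun x y => X.α a + X.β a * x + X.γ a * y

lemma dependsOn_contrib (A : X.Assumptions Wl Wh M) (p : ℝ) (a : ι) :
    DependsOn (X.contrib p a) (X.support a : Set ι) := by
  have h1 : DependsOn (fun t : ι → Bool => bit (t a)) (X.support a : Set ι) :=
    dependsOn_bit (by simp [support])
  have h2 : DependsOn (X.instrument a) (X.support a : Set ι) := by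
    refine dependsOn_sum_bit_mul fun r hr => by_contra fun hu => hr ?_
    simp [support, A.mem_outNbrs (A.u_support a r hu)]
  have h3 : DependsOn (fun t => X.weightHat p (fun t : ι → Bool => t) a t)
      (X.support a : Set ι) := by
    simp only [A.weightHat_eq]
    refine (dependsOn_sum_bit_mul fun r hr => ?_).comp_left fun x => x + _
    have hr' : r ∉ X.outNbrs a := fun h => hr (by simp [support, h])
    rw [edge_eq_zero hr', A.c_of_notMem fun h => hr' (A.mem_outNbrs h)]
    simp
  intro t t' ht
  have h1' := h1 ht
  have h3' := h3 ht
  simp only at h1' h3'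
  simp only [contrib, gammaHat]
  rw [A.dependsOn_outcome a ht, h2 ht, h3', h1']

lemma one_le_card_outNbrs (A : X.Assumptions Wl Wh M) (a : ι) : 1 ≤ (X.outNbrs a).card := by
  obtain ⟨r, hr⟩ := A.exists_u_ne_zero a
  exact Finset.card_pos.2 ⟨r, A.mem_outNbrs (A.u_support a r hr)⟩

lemma card_outNbrs_le_dA (X : UnipartiteExperiment ι) (a : ι) : (X.outNbrs a).card ≤ X.dA :=
  Finset.le_sup (f := fun a => (X.outNbrs a).card) (Finset.mem_univ a)

lemma card_inNbrs_le_dR (X : UnipartiteExperiment ι) (r : ι) : (X.inNbrs r).card ≤ X.dR :=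
  Finset.le_sup (f := fun r => (X.inNbrs r).card) (Finset.mem_univ r)

lemma one_le_dA (A : X.Assumptions Wl Wh M) (a : ι) : 1 ≤ X.dA :=
  (A.one_le_card_outNbrs a).trans (card_outNbrs_le_dA X a)

lemma one_le_dR (A : X.Assumptions Wl Wh M) (a : ι) : 1 ≤ X.dR := by
  obtain ⟨r, hr⟩ := A.exists_u_ne_zero a
  have : a ∈ X.inNbrs r := by simp [inNbrs, A.anchor a r (A.u_support a r hr)]
  exact (Finset.card_pos.2 ⟨a, this⟩ : 0 < _).trans_le (card_inNbrs_le_dR X r)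

lemma card_overlapNbrs_support_le (A : X.Assumptions Wl Wh M) (a : ι) :
    (overlapNbrs X.support a).card ≤ 4 * X.dA * X.dR := by
  classical
  have hsub : overlapNbrs X.support a ⊆
      (X.support a).biUnion fun r => insert r (X.inNbrs r) := by
    intro b hb
    rw [mem_overlapNbrs, Finset.not_disjoint_iff] at hb
    obtain ⟨r, hra, hrb⟩ := hb
    refine Finset.mem_biUnion.2 ⟨r, hra, ?_⟩
    simp only [support, Finset.mem_insert, outNbrs, Finset.mem_filter, Finset.mem_univ,
      true_and] at hrb
    simp only [Finset.mem_insert, inNbrs, Finset.mem_filter, Finset.mem_univ, true_and]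
    exact hrb.imp_left Eq.symm
  have h1 : (X.support a).card ≤ X.dA + 1 := by
    rw [support]
    exact (Finset.card_insert_le _ _).trans (Nat.add_le_add_right (card_outNbrs_le_dA X a) 1)
  have h2 : ∀ r ∈ X.support a, (insert r (X.inNbrs r)).card ≤ X.dR + 1 := fun r _ =>
    (Finset.card_insert_le _ _).trans (Nat.add_le_add_right (card_inNbrs_le_dR X r) 1)
  calc _ ≤ _ := Finset.card_le_card hsub
    _ ≤ (X.support a).card * (X.dR + 1) := Finset.card_biUnion_le_card_mul _ _ _ h2
    _ ≤ (X.dA + 1) * (X.dR + 1) := Nat.mul_le_mul_right _ h1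
    _ ≤ (2 * X.dA) * (2 * X.dR) := Nat.mul_le_mul (by linarith [A.one_le_dA a])
        (by linarith [A.one_le_dR a])
    _ = _ := by ring

/-! #### Boundedness -/

lemma Wh_nonneg (A : X.Assumptions Wl Wh M) (hWl : 0 < Wl) (a : ι) : 0 ≤ Wh := by
  obtain ⟨r, hr⟩ := A.exists_u_ne_zero a
  have hra : r ≠ a := fun h => hr (h ▸ A.u_self a)
  have hmem := A.mem_outNbrs (A.u_support a r hr)
  have hpos : (0 : ℝ) < (X.outNbrs a).card := by exact_mod_cast A.one_le_card_outNbrs a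
  have := (A.w_lower a r hmem hra).trans (A.w_upper a r hmem hra)
  exact hWl.le.trans ((div_le_div_iff_of_pos_right hpos).1 this)

lemma sum_abs_w_mul_edge_le (A : X.Assumptions Wl Wh M) (hWl : 0 < Wl) (a : ι) :
    ∑ r, |X.w a r| * X.edge a r ≤ Wh := by
  have hpos : (0 : ℝ) < (X.outNbrs a).card := by exact_mod_cast A.one_le_card_outNbrs a
  calc ∑ r, |X.w a r| * X.edge a r = ∑ r ∈ X.outNbrs a, |X.w a r| * X.edge a r := by
        refine (Finset.sum_subset (Finset.subset_univ _) fun r _ hr => ?_).symm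
        rw [edge_eq_zero hr, mul_zero]
    _ ≤ ∑ r ∈ X.outNbrs a, Wh / (X.outNbrs a).card := by
        refine Finset.sum_le_sum fun r hr => ?_
        rw [edge_eq_one_of_mem hr, mul_one]
        by_cases hra : r = a
        · rw [hra, A.w_self, abs_zero]
          exact div_nonneg (A.Wh_nonneg hWl a) hpos.le
        · exact A.w_upper a r hr hra
    _ = Wh := by
        rw [Finset.sum_const, nsmul_eq_mul]
        field_simp

lemma abs_weightHat_le (A : X.Assumptions Wl Wh M) (hWl : 0 < Wl) (hp : 0 < p) (hp1 : p ≤ 1)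
    (a : ι) (t : ι → Bool) : |X.weightHat p (fun t : ι → Bool => t) a t| ≤ Wh / p := by
  rw [A.weightHat_eq, ← Finset.sum_add_distrib]
  refine (Finset.abs_sum_le_sum_abs _ _).trans (le_trans ?_
    (div_le_div_of_nonneg_right (A.sum_abs_w_mul_edge_le hWl a) hp.le))
  rw [Finset.sum_div]
  refine Finset.sum_le_sum fun r _ => ?_
  by_cases h : (a, r) ∈ X.G
  · rw [A.c_of_mem h, A.edge_eq_one h]
    simp only [sub_self, mul_zero, zero_div, zero_add, mul_one]
    exact (le_div_iff₀ hp).2 (mul_le_of_le_one_right (abs_nonneg _) hp1)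
  · rw [A.c_of_notMem h, sub_zero, mul_zero, add_zero, abs_mul, abs_div, abs_mul, abs_of_pos hp,
      abs_of_nonneg (bit_nonneg _), abs_of_nonneg (show 0 ≤ X.edge a r from bit_nonneg _)]
    exact mul_le_of_le_one_left
      (div_nonneg (mul_nonneg (abs_nonneg _) (bit_nonneg _)) hp.le) (bit_le_one _)

lemma sum_u_pos (A : X.Assumptions Wl Wh M) (a : ι) : 0 < ∑ r, X.u a r := by
  obtain ⟨r, hr⟩ := A.exists_u_ne_zero a
  exact Finset.sum_pos' (fun r _ => A.u_nonneg a r)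
    ⟨r, Finset.mem_univ r, lt_of_le_of_ne (A.u_nonneg a r) hr.symm⟩

lemma le_abs_strength (A : X.Assumptions Wl Wh M) (a : ι) :
    Wl / (X.outNbrs a).card * ∑ r, X.u a r ≤ |X.strength a| := by
  obtain ⟨s, hs⟩ := A.exists_u_ne_zero a
  have hws : 0 < |X.w a s| := by
    have := A.w_same_sign a s s hs hs
    exact abs_pos.2 fun h => by simp [h] at this
  have hval : |X.w a s| * ∑ r, |X.w a r| * X.u a r = X.w a s * X.strength a := by
    rw [strength, Finset.mul_sum, Finset.mul_sum]
    refine Finset.sum_congr rfl fun r _ => ?_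
    by_cases hr : X.u a r = 0
    · simp [hr]
    · rw [← mul_assoc, ← mul_assoc, ← abs_mul, abs_of_pos (A.w_same_sign a s r hs hr)]
  have hle : Wl / (X.outNbrs a).card * ∑ r, X.u a r ≤ ∑ r, |X.w a r| * X.u a r := by
    rw [Finset.mul_sum]
    refine Finset.sum_le_sum fun r _ => ?_
    by_cases hr : X.u a r = 0
    · simp [hr]
    · refine mul_le_mul_of_nonneg_right ?_ (A.u_nonneg a r)
      exact A.w_lower a r (A.mem_outNbrs (A.u_support a r hr)) fun h => hr (h ▸ A.u_self a)
  refine hle.trans (le_of_mul_le_mul_left ?_ hws)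
  rw [hval, ← abs_mul]
  exact le_abs_self _

lemma strength_ne_zero (A : X.Assumptions Wl Wh M) (hWl : 0 < Wl) (a : ι) :
    X.strength a ≠ 0 := by
  have hpos : (0 : ℝ) < (X.outNbrs a).card := by exact_mod_cast A.one_le_card_outNbrs a
  exact abs_pos.1 ((mul_pos (div_pos hWl hpos) (A.sum_u_pos a)).trans_le (A.le_abs_strength a))

lemma abs_instrument_sub_le (A : X.Assumptions Wl Wh M) (hp : 0 ≤ p) (hp1 : p ≤ 1) (a : ι)
    (t : ι → Bool) : |X.instrument a t - p * ∑ r, X.u a r| ≤ ∑ r, X.u a r := by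
  rw [instrument, Finset.mul_sum, ← Finset.sum_sub_distrib]
  refine (Finset.abs_sum_le_sum_abs _ _).trans (Finset.sum_le_sum fun r _ => ?_)
  rw [← sub_mul, abs_mul, abs_of_nonneg (A.u_nonneg a r)]
  refine mul_le_of_le_one_left (A.u_nonneg a r) (abs_le.2 ⟨?_, ?_⟩)
  · linarith [bit_nonneg (t r)]
  · linarith [bit_le_one (t r)]

lemma M_nonneg (A : X.Assumptions Wl Wh M) (a : ι) : 0 ≤ M :=
  (abs_nonneg _).trans (A.outcome_bound a fun _ => true)

lemma abs_gammaHat_le (A : X.Assumptions Wl Wh M) {p₀ : ℝ} (hp₀ : 0 < p₀) (hp : p₀ ≤ p)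
    (hp1 : p ≤ 1 - p₀) (a : ι) (t : ι → Bool) :
    |X.gammaHat p (fun t : ι → Bool => t) a t| ≤ M / p₀ := by
  have hM := A.M_nonneg a
  have hY := A.outcome_bound a t
  rw [gammaHat]
  cases h : t a
  · simp only [bit, Bool.false_eq_true, if_false, zero_mul, zero_div, zero_sub, sub_zero, one_mul,
      abs_neg, abs_div]
    rw [abs_of_pos (show 0 < 1 - p by linarith)]
    exact div_le_div₀ hM hY hp₀ (by linarith)
  · simp only [bit, if_true, one_mul, sub_self, zero_mul, zero_div, sub_zero, abs_div]
    rw [abs_of_pos (show 0 < p by linarith)]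
    exact div_le_div₀ hM hY hp₀ hp

lemma abs_contrib_le (A : X.Assumptions Wl Wh M) (hWl : 0 < Wl) {p₀ : ℝ} (hp₀ : 0 < p₀)
    (hp : p₀ ≤ p) (hp1 : p ≤ 1 - p₀) (a : ι) (t : ι → Bool) :
    |X.contrib p a t| ≤ (M * Wh / (p₀ ^ 3 * Wl) + M / p₀) * X.dA := by
  have hM := A.M_nonneg a
  have hWh := A.Wh_nonneg hWl a
  have hp' : 0 < p := hp₀.trans_le hp
  have hq' : p₀ ≤ 1 - p := by linarith
  have hd1 : (1 : ℝ) ≤ X.dA := by exact_mod_cast A.one_le_dA a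
  have hR : (0 : ℝ) < (X.outNbrs a).card := by exact_mod_cast A.one_le_card_outNbrs a
  have hRd : ((X.outNbrs a).card : ℝ) ≤ X.dA := by exact_mod_cast card_outNbrs_le_dA X a
  have hU := A.sum_u_pos a
  have hbeta : |X.outcome a t * (X.instrument a t - p * ∑ r, X.u a r) /
      (p * (1 - p) * X.strength a)| ≤ M * X.dA / (p₀ ^ 2 * Wl) := by
    rw [abs_div, abs_mul, abs_mul, abs_of_pos (mul_pos hp' (hp₀.trans_le hq'))]
    calc _ ≤ M * (∑ r, X.u a r) / (p₀ * p₀ * (Wl / X.dA * ∑ r, X.u a r)) := by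
          refine div_le_div₀ (by positivity)
            (mul_le_mul (A.outcome_bound a t) (A.abs_instrument_sub_le hp'.le (by linarith) a t)
              (abs_nonneg _) hM) (by positivity) ?_
          refine mul_le_mul (mul_le_mul hp hq' hp₀.le hp'.le) (le_trans ?_ (A.le_abs_strength a))
            (by positivity) (mul_pos hp' (hp₀.trans_le hq')).le
          gcongr
      _ = _ := by field_simp
  have hw := A.abs_weightHat_le hWl hp' (by linarith) a t
  have hw' : |X.weightHat p (fun t : ι → Bool => t) a t| ≤ Wh / p₀ :=
    hw.trans (div_le_div_of_nonneg_left hWh hp₀ hp)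
  rw [contrib]
  refine (abs_add_le _ _).trans ?_
  rw [abs_mul]
  calc _ ≤ M * X.dA / (p₀ ^ 2 * Wl) * (Wh / p₀) + M / p₀ := by
        refine add_le_add (mul_le_mul hbeta hw' (abs_nonneg _) (by positivity))
          (A.abs_gammaHat_le hp₀ hp hp1 a t)
    _ ≤ M * X.dA / (p₀ ^ 2 * Wl) * (Wh / p₀) + M / p₀ * X.dA := by
        gcongr
        exact le_mul_of_one_le_right (by positivity) hd1
    _ = _ := by field_simp

/-! #### Unbiasedness -/

lemma integral_gammaHat [IsProbabilityMeasure P] (A : X.Assumptions Wl Wh M)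
    (h : IsBernoulliDesign P p T) (hp : p ≠ 0) (hp1 : 1 - p ≠ 0) (a : ι) :
    ∫ ω, X.gammaHat p (fun t : ι → Bool => t) a (T ω) ∂P = X.γ a := by
  classical
  set g : (ι → Bool) → ℝ := fun t => bit (t a) / p - (1 - bit (t a)) / (1 - p) with hg
  set f : (ι → Bool) → ℝ := fun t => X.α a + X.β a * X.exposure a t with hf
  have hinteg : ∀ f : (ι → Bool) → ℝ, Integrable (fun ω => f (T ω)) P :=
    fun f => integrable_comp_of_bits h.measurable f
  have hdg : DependsOn g (({a} : Finset ι) : Set ι) := fun t t' ht => by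
    simp only [hg]; rw [ht a (by simp)]
  have hdf : DependsOn f ((({a} : Finset ι)ᶜ : Finset ι) : Set ι) := by
    have : DependsOn (X.exposure a) ((({a} : Finset ι)ᶜ : Finset ι) : Set ι) := by
      rw [funext (A.exposure_eq a)]
      refine dependsOn_sum_bit_mul fun r hr => ?_
      have : r = a := by simpa using hr
      rw [this, A.w_self, mul_zero]
    exact this.comp_left fun x => X.α a + X.β a * x
  have hEg : ∫ ω, g (T ω) ∂P = 0 := by
    simp only [hg]
    rw [integral_sub (hinteg fun t => bit (t a) / p) (hinteg fun t => (1 - bit (t a)) / (1 - p)),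
      integral_div, integral_div, integral_sub (integrable_const _) (hinteg fun t => bit (t a)),
      h.integral_bit]
    simp [hp, hp1]
  have hdec : ∀ t, X.gammaHat p (fun t : ι → Bool => t) a t = g t * f t + X.γ a / p * bit (t a) := by
    intro t
    simp only [gammaHat, outcome, hg, hf]
    linear_combination (X.γ a / p + X.γ a / (1 - p)) * bit_mul_self (t a)
  simp only [hdec]
  rw [integral_add (hinteg fun t => g t * f t) (hinteg fun t => X.γ a / p * bit (t a)),
    integral_mul_of_dependsOn h.measurable h.indep hdg hdf disjoint_compl_right, hEg,
    integral_const_mul, h.integral_bit]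
  field_simp
  simp

lemma integral_weightHat [IsProbabilityMeasure P] (A : X.Assumptions Wl Wh M)
    (h : IsBernoulliDesign P p T) (hp : p ≠ 0) (a : ι) :
    ∫ ω, X.weightHat p (fun t : ι → Bool => t) a (T ω) ∂P = X.exposure a fun _ => true := by
  simp only [A.weightHat_eq, A.exposure_eq]
  rw [integral_add (integrable_comp_of_bits h.measurable
    fun t => ∑ r, bit (t r) * (X.w a r * (X.edge a r - X.c a r) / p)) (integrable_const _),
    h.integral_sum_bit_mul, Finset.mul_sum, integral_const, probReal_univ, one_smul,
    ← Finset.sum_add_distrib]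
  refine Finset.sum_congr rfl fun r _ => ?_
  simp only [bit, if_true]
  field_simp
  ring

lemma integral_outcome_mul_instrument_mul_weightHat [IsProbabilityMeasure P]
    (A : X.Assumptions Wl Wh M) (h : IsBernoulliDesign P p T) (hp : p ≠ 0) (a : ι) :
    ∫ ω, X.outcome a (T ω) * (X.instrument a (T ω) - p * ∑ r, X.u a r) *
        X.weightHat p (fun t : ι → Bool => t) a (T ω) ∂P =
      p * (1 - p) * X.strength a * (X.β a * X.exposure a fun _ => true) := by
  classical
  have hinteg : ∀ f : (ι → Bool) → ℝ, Integrable (fun ω => f (T ω)) P :=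
    fun f => integrable_comp_of_bits h.measurable f
  set V : Finset ι := Finset.univ.filter fun r => (a, r) ∈ X.G ∧ r ≠ a with hV
  set ζ : (ι → Bool) → ℝ := fun t => X.instrument a t - p * ∑ r, X.u a r with hζ
  set xG : (ι → Bool) → ℝ := fun t => ∑ r, bit (t r) * (X.c a r * X.w a r) with hxG
  set xS : (ι → Bool) → ℝ := fun t => ∑ r, bit (t r) * ((X.edge a r - X.c a r) * X.w a r) with hxS
  set ω' : (ι → Bool) → ℝ := fun t => X.weightHat p (fun t : ι → Bool => t) a t with hω'
  have hnotV : ∀ r, r ∉ (V : Set ι) → r ≠ a → (a, r) ∉ X.G := fun r hr hra hG =>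
    hr (by simp [hV, hra, hG])
  have hdζ : DependsOn ζ (V : Set ι) := by
    have : DependsOn (X.instrument a) (V : Set ι) :=
      dependsOn_sum_bit_mul fun r hr => by
        by_contra hu
        exact hnotV r hr (fun h => hu (h ▸ A.u_self a)) (A.u_support a r hu)
    exact this.comp_left fun x => x - _
  have hdG : DependsOn xG (V : Set ι) := dependsOn_sum_bit_mul fun r hr => by
    by_cases hra : r = a
    · rw [hra, A.w_self, mul_zero]
    · rw [A.c_of_notMem (hnotV r hr hra), zero_mul]
  have hVc : ∀ r, r ∉ ((Vᶜ : Finset ι) : Set ι) → X.edge a r - X.c a r = 0 := by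
    intro r hr
    have hr' : (a, r) ∈ X.G := by
      have : r ∈ V := by simpa using hr
      exact (Finset.mem_filter.1 this).2.1
    rw [A.edge_eq_one hr', A.c_of_mem hr', sub_self]
  have hdS : DependsOn xS ((Vᶜ : Finset ι) : Set ι) := dependsOn_sum_bit_mul fun r hr => by
    rw [hVc r hr, zero_mul]
  have hdW : DependsOn ω' ((Vᶜ : Finset ι) : Set ι) := by
    simp only [hω', A.weightHat_eq]
    refine (dependsOn_sum_bit_mul fun r hr => ?_).comp_left fun x => x + _
    rw [hVc r hr, mul_zero, zero_div]
  have hda : DependsOn (fun t : ι → Bool => bit (t a)) ((Vᶜ : Finset ι) : Set ι) :=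
    dependsOn_bit (by simp [hV])
  have hdrest : DependsOn (fun t => (X.α a + X.β a * xS t + X.γ a * bit (t a)) * ω' t)
      ((Vᶜ : Finset ι) : Set ι) :=
    (hdS.comp_left₂ hda fun x y => X.α a + X.β a * x + X.γ a * y).comp_left₂ hdW (· * ·)
  have hEζ : ∫ ω, ζ (T ω) ∂P = 0 := by
    simp only [hζ]
    rw [integral_sub (hinteg (X.instrument a)) (integrable_const _), integral_instrument h]
    simp
  have hEG : ∫ ω, xG (T ω) * ζ (T ω) ∂P = p * (1 - p) * X.strength a := by
    have hcov : cov[fun ω => xG (T ω), fun ω => X.instrument a (T ω); P] = _ :=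
      h.covariance_sum_bit_mul (fun r => X.c a r * X.w a r) (X.u a)
    rw [covariance_eq_sub (memLp_comp_of_bits h.measurable xG 2)
      (memLp_comp_of_bits h.measurable (X.instrument a) 2)] at hcov
    have hst : X.strength a = ∑ r, X.c a r * X.w a r * X.u a r :=
      Finset.sum_congr rfl fun r _ => by linear_combination -X.w a r * A.c_mul_u a r
    rw [hst, ← hcov]
    simp only [hζ, mul_sub]
    rw [integral_sub (hinteg fun t => xG t * X.instrument a t)
      (hinteg fun t => xG t * (p * ∑ r, X.u a r)), integral_mul_const, ← integral_instrument h]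
    rfl
  have hdec : ∀ t, X.outcome a t * ζ t * ω' t = X.β a * (xG t * ζ t * ω' t) +
      ζ t * ((X.α a + X.β a * xS t + X.γ a * bit (t a)) * ω' t) := by
    intro t
    have : X.exposure a t = xG t + xS t := by
      rw [A.exposure_eq, ← Finset.sum_add_distrib]
      exact Finset.sum_congr rfl fun r _ => by ring
    rw [outcome, this]
    ring
  change ∫ ω, X.outcome a (T ω) * ζ (T ω) * ω' (T ω) ∂P = _
  simp only [hdec]
  rw [integral_add (hinteg fun t => X.β a * (xG t * ζ t * ω' t))
      (hinteg fun t => ζ t * ((X.α a + X.β a * xS t + X.γ a * bit (t a)) * ω' t)),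
    integral_const_mul,
    integral_mul_of_dependsOn h.measurable h.indep (f := fun t => xG t * ζ t) (g := ω')
      (hdG.comp_left₂ hdζ (· * ·)) hdW disjoint_compl_right,
    integral_mul_of_dependsOn h.measurable h.indep hdζ hdrest disjoint_compl_right, hEζ, hEG,
    A.integral_weightHat h hp]
  ring

lemma integral_contrib [IsProbabilityMeasure P] (A : X.Assumptions Wl Wh M) (hWl : 0 < Wl)
    (h : IsBernoulliDesign P p T) (hp : p ≠ 0) (hp1 : 1 - p ≠ 0) (a : ι) :
    ∫ ω, X.contrib p a (T ω) ∂P =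
      X.outcome a (fun _ => true) - X.outcome a (fun _ => false) := by
  have hinteg : ∀ f : (ι → Bool) → ℝ, Integrable (fun ω => f (T ω)) P :=
    fun f => integrable_comp_of_bits h.measurable f
  have hs := A.strength_ne_zero hWl a
  simp only [contrib, div_mul_eq_mul_div]
  rw [integral_add (hinteg fun t => X.outcome a t * (X.instrument a t - p * ∑ r, X.u a r) *
      X.weightHat p (fun t : ι → Bool => t) a t / (p * (1 - p) * X.strength a))
      (hinteg fun t => X.gammaHat p (fun t : ι → Bool => t) a t), integral_div,
    A.integral_outcome_mul_instrument_mul_weightHat h hp, A.integral_gammaHat h hp hp1,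
    mul_div_cancel_left₀ _ (mul_ne_zero (mul_ne_zero hp hp1) hs)]
  have : X.exposure a (fun _ => false) = 0 := by simp [exposure, bit]
  simp only [outcome, this, bit, if_true, Bool.false_eq_true, if_false]
  ring

lemma integral_muHat [IsProbabilityMeasure P] (A : X.Assumptions Wl Wh M) (hWl : 0 < Wl)
    (h : IsBernoulliDesign P p T) (hp : p ≠ 0) (hp1 : 1 - p ≠ 0) :
    ∫ ω, X.muHat P p T ω ∂P = X.totalEffect := by
  rw [A.muHat_eq h, integral_const_mul,
    integral_finsetSum _ fun a _ => integrable_comp_of_bits h.measurable (X.contrib p a)]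
  simp only [A.integral_contrib hWl h hp hp1, totalEffect]

end Assumptions

end UnipartiteExperiment

namespace UnipartiteExperiment.Assumptions

variable {ι : Type*} [Fintype ι] {Ω : Type*} [MeasurableSpace Ω] {P : Measure Ω}
  [IsProbabilityMeasure P] {p p₀ : ℝ} {T : Ω → ι → Bool} {X : UnipartiteExperiment ι} {Wl Wh M : ℝ}

lemma variance_muHat_le (A : X.Assumptions Wl Wh M) (hWl : 0 < Wl) (hp₀ : 0 < p₀) (hp : p₀ ≤ p)
    (hp1 : p ≤ 1 - p₀) (h : IsBernoulliDesign P p T) :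
    Var[X.muHat P p T; P] ≤ 8 * (M * Wh / (p₀ ^ 3 * Wl) + M / p₀) ^ 2 *
      ((X.dA : ℝ) ^ 3 * (X.dR : ℝ) / (Fintype.card ι : ℝ)) := by
  classical
  have hv := variance_sum_le_of_dependsOn (P := P) h.measurable h.indep Finset.univ
    (A.dependsOn_contrib p) (fun a _ t => A.abs_contrib_le hWl hp₀ hp hp1 a t)
    (D := 4 * X.dA * X.dR) (fun a _ => by
      rw [show Finset.univ.filter (fun b => ¬ Disjoint (X.support a) (X.support b)) =
        overlapNbrs X.support a by ext b; simp [mem_overlapNbrs]]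
      exact_mod_cast A.card_overlapNbrs_support_le a)
  rw [A.muHat_eq h, variance_const_mul]
  refine (mul_le_mul_of_nonneg_left hv (sq_nonneg _)).trans (le_of_eq ?_)
  rw [Finset.card_univ]
  rcases eq_or_ne (Fintype.card ι : ℝ) 0 with h0 | h0
  · simp [h0]
  · field_simp
    ring

lemma memLp_muHat (A : X.Assumptions Wl Wh M) (h : IsBernoulliDesign P p T) :
    MemLp (X.muHat P p T) 2 P := by
  rw [A.muHat_eq h]
  exact memLp_comp_of_bits h.measurable
    (fun t => (1 / (Fintype.card ι : ℝ)) * ∑ a, X.contrib p a t) 2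

/-- The characteristic function of the standardized estimator is close to that of the standard
normal distribution. -/
lemma norm_charFun_standardized_sub_le (A : X.Assumptions Wl Wh M) (hWl : 0 < Wl) (hp₀ : 0 < p₀)
    (hp : p₀ ≤ p) (hp1 : p ≤ 1 - p₀) (h : IsBernoulliDesign P p T) {δ : ℝ} (hδ : 0 < δ)
    (hvar : δ ≤ (Fintype.card ι : ℝ) * Var[X.muHat P p T; P]) {K L : ℝ}
    (hK : K = M * Wh / (p₀ ^ 3 * Wl) + M / p₀)
    (hL : L = (X.dA : ℝ) ^ 10 * (X.dR : ℝ) ^ 4 / (Fintype.card ι : ℝ)) (t : ℝ) :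
    ‖charFun (P.map fun ω => (X.muHat P p T ω - X.totalEffect) /
        Real.sqrt (Var[X.muHat P p T; P])) t - charFun (gaussianReal 0 1) t‖ ≤
      |t| * (|t| * Real.sqrt (8192 * K ^ 4 / δ ^ 2 * L) +
        t ^ 2 * (256 * K ^ 3 / Real.sqrt δ ^ 3 * Real.sqrt L)) := by
  have hp0 : p ≠ 0 := (hp₀.trans_le hp).ne'
  have hp1' : 1 - p ≠ 0 := by linarith
  set n : ℝ := (Fintype.card ι : ℝ) with hn
  set v : ℝ := Var[X.muHat P p T; P] with hv
  have hn0 : 0 < n := by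
    refine lt_of_le_of_ne (Nat.cast_nonneg _) fun h0 => ?_
    rw [← h0, zero_mul] at hvar
    linarith
  have hv0 : 0 < v := pos_of_mul_pos_right (hδ.trans_le hvar) hn0.le
  have hne : Nonempty ι := Fintype.card_pos_iff.1 (Nat.cast_pos.1 hn0)
  obtain ⟨a₀⟩ := hne
  have hd1 : (1 : ℝ) ≤ X.dA := by exact_mod_cast A.one_le_dA a₀
  have hd2 : (1 : ℝ) ≤ X.dR := by exact_mod_cast A.one_le_dR a₀
  have hK0 : 0 ≤ K := by
    have := A.M_nonneg a₀
    have := A.Wh_nonneg hWl a₀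
    rw [hK]
    positivity
  have hcb : ∀ a t, |X.contrib p a t| ≤ K * X.dA := fun a t => by
    rw [hK]; exact A.abs_contrib_le hWl hp₀ hp hp1 a t
  set g : ι → (ι → Bool) → ℝ := fun a t =>
    (X.contrib p a t - ∫ ω, X.contrib p a (T ω) ∂P) / (n * Real.sqrt v) with hg
  have hsv : 0 < Real.sqrt v := Real.sqrt_pos.2 hv0
  have hscale : Real.sqrt (δ * n) ≤ n * Real.sqrt v := by
    rw [Real.sqrt_le_left (by positivity), mul_pow, Real.sq_sqrt hv0.le]
    nlinarith
  have hsδ : 0 < Real.sqrt (δ * n) := Real.sqrt_pos.2 (by positivity)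
  have hgB : ∀ a t, |g a t| ≤ 2 * K * X.dA / Real.sqrt (δ * n) := by
    intro a t
    simp only [hg]
    rw [abs_div, abs_of_pos (by positivity : 0 < n * Real.sqrt v)]
    refine div_le_div₀ (by positivity) ?_ hsδ hscale
    have h1 := hcb a t
    have h2 : |∫ ω, X.contrib p a (T ω) ∂P| ≤ K * X.dA :=
      abs_integral_le_of_abs_le fun ω => hcb a _
    linarith [abs_sub (X.contrib p a t) (∫ ω, X.contrib p a (T ω) ∂P)]
  have hgdep : ∀ a, DependsOn (g a) (X.support a : Set ι) := fun a =>
    (A.dependsOn_contrib p a).comp_left fun x =>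
      (x - ∫ ω, X.contrib p a (T ω) ∂P) / (n * Real.sqrt v)
  have hg0 : ∀ a, ∫ ω, g a (T ω) ∂P = 0 := by
    intro a
    simp only [hg]
    rw [integral_div, integral_sub (integrable_comp_of_bits h.measurable (X.contrib p a))
      (integrable_const _)]
    simp
  have hsum : ∀ ω, ∑ a, g a (T ω) = (X.muHat P p T ω - X.totalEffect) / Real.sqrt v := by
    intro ω
    simp only [hg]
    rw [← Finset.sum_div, Finset.sum_sub_distrib, A.muHat_eq h, totalEffect, ← hn]
    simp only [A.integral_contrib hWl h hp0 hp1']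
    field_simp
  have hg1 : ∫ ω, (∑ a, g a (T ω)) ^ 2 ∂P = 1 := by
    simp only [hsum, div_pow, Real.sq_sqrt hv0.le]
    rw [integral_div, ← A.integral_muHat hWl h hp0 hp1',
      ← variance_eq_integral (A.memLp_muHat h).1.aemeasurable]
    exact div_self hv0.ne'
  have hmain := norm_charFun_sub_gaussian_le h.measurable h.indep hgdep hgB (by positivity)
    A.card_overlapNbrs_support_le hg0 hg1 t
  simp only [hsum] at hmain
  refine hmain.trans ?_
  have hs2 : Real.sqrt (δ * n) ^ 2 = δ * n := Real.sq_sqrt (by positivity)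
  gcongr |t| * (|t| * Real.sqrt ?_ + t ^ 2 * ?_)
  · rw [hL]
    have e4 : Real.sqrt (δ * n) ^ 4 = (δ * n) ^ 2 := by
      rw [show 4 = 2 * 2 from rfl, pow_mul, hs2]
    have hpow : (X.dA : ℝ) ^ 7 * (X.dR : ℝ) ^ 3 ≤ (X.dA : ℝ) ^ 10 * (X.dR : ℝ) ^ 4 :=
      mul_le_mul (pow_le_pow_right₀ hd1 (by norm_num)) (pow_le_pow_right₀ hd2 (by norm_num))
        (by positivity) (by positivity)
    calc _ = 8192 * K ^ 4 / δ ^ 2 * ((X.dA : ℝ) ^ 7 * (X.dR : ℝ) ^ 3 / n) := by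
          rw [div_pow, e4]
          push_cast
          field_simp
          ring
      _ ≤ _ := by gcongr
  · have hsL : Real.sqrt L = (X.dA : ℝ) ^ 5 * (X.dR : ℝ) ^ 2 / Real.sqrt n := by
      rw [hL, Real.sqrt_div (by positivity)]
      congr 1
      rw [show (X.dA : ℝ) ^ 10 * (X.dR : ℝ) ^ 4 = ((X.dA : ℝ) ^ 5 * (X.dR : ℝ) ^ 2) ^ 2 by ring]
      exact Real.sqrt_sq (by positivity)
    refine le_of_eq ?_
    have hsn : Real.sqrt n ^ 2 = n := Real.sq_sqrt hn0.le
    have hsn0 : 0 < Real.sqrt n := Real.sqrt_pos.2 hn0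
    have hsd0 : 0 < Real.sqrt δ := Real.sqrt_pos.2 hδ
    rw [hsL, Real.sqrt_mul hδ.le, ← hn]
    push_cast
    nth_rewrite 1 [← hsn]
    field_simp
    ring

end UnipartiteExperiment.Assumptions

theorem corollary2 (p₀ Wl Wh M : ℝ) (hp₀ : 0 < p₀) (hWl : 0 < Wl) :
    -- the variance bound, with a constant depending only on `p₀`, `Wl`, `Wh`, `M`
    (∃ C : ℝ, ∀ (ι : Type*) [Fintype ι] (Ω : Type*) [MeasurableSpace Ω]
      (P : Measure Ω) [IsProbabilityMeasure P] (p : ℝ) (T : Ω → ι → Bool)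
      (X : UnipartiteExperiment ι),
      p₀ ≤ p → p ≤ 1 - p₀ → UnipartiteExperiment.IsBernoulliDesign P p T →
      X.Assumptions Wl Wh M →
      Var[X.muHat P p T; P] ≤ C * ((X.dA : ℝ) ^ 3 * (X.dR : ℝ) / (Fintype.card ι : ℝ))) ∧
    -- consistency and asymptotic normality along sequences of experiments
    (∀ (ι : ℕ → Type*) [∀ n, Fintype (ι n)] (Ω : ℕ → Type*) [∀ n, MeasurableSpace (Ω n)]
      (P : ∀ n, Measure (Ω n)) [∀ n, IsProbabilityMeasure (P n)] (p : ℕ → ℝ)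
      (T : ∀ n, Ω n → ι n → Bool) (X : ∀ n, UnipartiteExperiment (ι n)),
      (∀ n, p₀ ≤ p n ∧ p n ≤ 1 - p₀) →
      (∀ n, UnipartiteExperiment.IsBernoulliDesign (P n) (p n) (T n)) →
      (∀ n, (X n).Assumptions Wl Wh M) →
      (Tendsto (fun n => ((X n).dA : ℝ) ^ 3 * ((X n).dR : ℝ) / (Fintype.card (ι n) : ℝ))
          atTop (𝓝 0) →
        ∀ ε : ℝ, 0 < ε →
          Tendsto (fun n => P n {ω | ε ≤ |(X n).muHat (P n) (p n) (T n) ω - (X n).totalEffect|})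
            atTop (𝓝 0)) ∧
      ((∃ δ : ℝ, 0 < δ ∧ ∀ᶠ n in atTop,
          δ ≤ (Fintype.card (ι n) : ℝ) * Var[(X n).muHat (P n) (p n) (T n); P n]) →
        Tendsto (fun n => ((X n).dA : ℝ) ^ 10 * ((X n).dR : ℝ) ^ 4 / (Fintype.card (ι n) : ℝ))
          atTop (𝓝 0) →
        TendstoInDistribution
          (fun n ω => ((X n).muHat (P n) (p n) (T n) ω - (X n).totalEffect) /
            Real.sqrt (Var[(X n).muHat (P n) (p n) (T n); P n]))
          atTop (id : ℝ → ℝ) P (gaussianReal 0 1))) := by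
  refine ⟨⟨8 * (M * Wh / (p₀ ^ 3 * Wl) + M / p₀) ^ 2, ?_⟩, ?_⟩
  · intro ι _ Ω _ P _ p T X hp hp1 h A
    exact A.variance_muHat_le hWl hp₀ hp hp1 h
  intro ι _ Ω _ P _ p T X hp h A
  have hp0 : ∀ n, p n ≠ 0 := fun n => (hp₀.trans_le (hp n).1).ne'
  have hp1 : ∀ n, 1 - p n ≠ 0 := fun n => by linarith [(hp n).2]
  refine ⟨fun hlim ε hε => ?_, ?_⟩
  · set C : ℝ := 8 * (M * Wh / (p₀ ^ 3 * Wl) + M / p₀) ^ 2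
    have hbound : ∀ n, P n {ω | ε ≤ |(X n).muHat (P n) (p n) (T n) ω - (X n).totalEffect|} ≤
        ENNReal.ofReal (C * (((X n).dA : ℝ) ^ 3 * ((X n).dR : ℝ) / (Fintype.card (ι n) : ℝ)) /
          ε ^ 2) := by
      intro n
      rw [← (A n).integral_muHat hWl (h n) (hp0 n) (hp1 n)]
      refine (meas_ge_le_variance_div_sq ((A n).memLp_muHat (h n)) hε).trans
        (ENNReal.ofReal_le_ofReal ?_)
      exact div_le_div_of_nonneg_right
        ((A n).variance_muHat_le hWl hp₀ (hp n).1 (hp n).2 (h n)) (sq_nonneg ε)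
    refine tendsto_of_tendsto_of_tendsto_of_le_of_le tendsto_const_nhds ?_ (fun _ => zero_le)
      hbound
    have := ENNReal.tendsto_ofReal ((hlim.const_mul C).div_const (ε ^ 2))
    simpa using this
  · rintro ⟨δ, hδ, hvar⟩ hlim
    have hmeas : ∀ n, AEMeasurable (fun ω => ((X n).muHat (P n) (p n) (T n) ω -
        (X n).totalEffect) / Real.sqrt (Var[(X n).muHat (P n) (p n) (T n); P n])) (P n) :=
      fun n => (((A n).memLp_muHat (h n)).1.aemeasurable.sub_const _).div_const _
    refine ⟨hmeas, aemeasurable_id, ?_⟩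
    refine ProbabilityMeasure.tendsto_iff_tendsto_charFun.2 fun t => ?_
    simp only [ProbabilityMeasure.coe_mk, Measure.map_id]
    rw [tendsto_iff_norm_sub_tendsto_zero]
    set K : ℝ := M * Wh / (p₀ ^ 3 * Wl) + M / p₀ with hK
    refine squeeze_zero' (Eventually.of_forall fun _ => norm_nonneg _)
      (hvar.mono fun n hn => (A n).norm_charFun_standardized_sub_le hWl hp₀ (hp n).1 (hp n).2 (h n)
        hδ hn hK rfl t) ?_
    have h1 := (hlim.const_mul (8192 * K ^ 4 / δ ^ 2)).sqrt.const_mul |t|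
    have h2 := (hlim.sqrt.const_mul (256 * K ^ 3 / Real.sqrt δ ^ 3)).const_mul (t ^ 2)
    have := (h1.add h2).const_mul |t|
    simpa using this
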